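/- Let $\mathcal X$ be any set, $n\in\mathbb N$, $\rho\in(0,\infty)$, and let $d_H(\mathbf X,\mathbf Y)=\#\{k: X_k\ne Y_k\}$ be the Hamming distance on $\mathcal X^n$. A randomized mechanism $M$ on $\mathcal X^n$ with codomain a measurable space $\mathcal Y$ assigns to each $\mathbf X\in\mathcal X^n$ a random output $M(\mathbf X)$ in $\mathcal Y$, that is, a probability distribution on $\mathcal Y$. For probability distributions $P,Q$ on the same measurable space and $\alpha>1$, the Rényi divergence is $$D_\alpha(P\|Q)=\frac1{\alpha-1}\ln\int\Bigl(\frac{dP}{dQ}\Bigr)^{\alpha-1}dP\in[0,+\infty]$$ if $P\ll Q$, and $D_\alpha(P\|Q)=+\infty$ otherwise. The mechanism $M$ is $\rho$-zero concentrated differentially private ($\rho$-zCDP) if, for all $\mathbf X,\mathbf Y\in\mathcal X^n$ with $d_H(\mathbf X,\mathbf Y)\le 1$, one has $D_\alpha(M(\mathbf X)\|M(\mathbf Y))\le\rho\alpha$ for all $1<\alpha<\infty$. A function $s:(\mathcal X^n)^N\to\mathbb R$ is called an admissible similarity function for $\rho$-zCDP if, for every $\rho$-zCDP mechanism $M$ on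 $\mathcal X^n$ (with any measurable codomain $\mathcal Y$), every measurable test function $\Psi:\mathcal Y\to\{1,\dots,N\}$, and all $\mathbf X_1,\dots,\mathbf X_N\in\mathcal X^n$, $$\frac1N\sum_{i=1}^N\mathbb P_M\bigl(\Psi(M(\mathbf X_i))\neq i\bigr)\ \ge\ s(\mathbf X_1,\dots,\mathbf X_N).$$ **Theorem (admissible similarity functions for $\rho$-zCDP).** The following functions are admissible similarity functions for $\rho$-zCDP. 1. (Fano matching) For every integer $N\ge2$, $$s(\mathbf X_1,\dots,\mathbf X_N)=1-\frac{1+\frac{\rho}{N^2}\sum_{i=1}^N\sum_{j=1}^N d_H(\mathbf X_i,\mathbf X_j)^2}{\ln N}.$$ 2. (Le Cam matching) For $N=2$, $$s(\mathbf X_1,\mathbf X_2)=\frac12\Bigl(1-\sqrt{\rho/2}\;d_H(\mathbf X_1,\mathbf X_2)\Bigr).$$ -/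

import Mathlib

open MeasureTheory

universe u w

/-- The Rényi divergence of level `α ∈ [1, ∞)` between two probability distributions: the
Kullback-Leibler divergence for `α = 1`, and `(α - 1)⁻¹ * ln ∫ (dP/dQ)^(α - 1) dP` for `α > 1`, when
`P` is absolutely continuous with respect to `Q`. It is `+∞` when `P` is not absolutely continuous
with respect to `Q`. The integral is the Lebesgue integral in `[0, ∞]` and `ENNReal.log` is the
natural logarithm extended by `log ∞ = ∞`, so the value is `+∞` if the integral diverges.
(Levels `α < 1` are not used.) -/
noncomputable def renyiDiv {Ω : Type*} [MeasurableSpace Ω] (α : ℝ) (P Q : Measure Ω) : EReal :=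
  open Classical in
  if P ≪ Q then
    if α = 1 then ((InformationTheory.klDiv P Q : ENNReal) : EReal)
    else (((α - 1)⁻¹ : ℝ) : EReal) * ENNReal.log (∫⁻ x, (P.rnDeriv Q x) ^ (α - 1) ∂P)
  else ⊤

/-- A randomized mechanism on datasets of `n` records from `𝒳` with values in the measurable
space `𝒴`, given by the law of its output `M X` for each dataset `X`. -/
abbrev Mechanism (𝒳 : Type u) (n : ℕ) (𝒴 : Type w) [MeasurableSpace 𝒴] : Type (max u w) :=
  (Fin n → 𝒳) → ProbabilityMeasure 𝒴

/-- A condition on randomized mechanisms on `𝒳 ^ n`, whatever their codomain. -/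
abbrev MechanismCondition (𝒳 : Type u) (n : ℕ) : Type (max u (w + 1)) :=
  ∀ (𝒴 : Type w) [MeasurableSpace 𝒴], Mechanism 𝒳 n 𝒴 → Prop

/-- `ρ`-zero concentrated differential privacy. -/
def ZCDP {𝒳 : Type u} [DecidableEq 𝒳] {n : ℕ} (ρ : ℝ) : MechanismCondition.{u, w} 𝒳 n :=
  fun 𝒴 _ (M : Mechanism 𝒳 n 𝒴) =>
    ∀ X Y : Fin n → 𝒳, hammingDist X Y ≤ 1 →
      ∀ α : ℝ, 1 < α →
        renyiDiv α (M X : Measure 𝒴) (M Y : Measure 𝒴) ≤ ((ρ * α : ℝ) : EReal)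

/-- A similarity function `s : (𝒳 ^ n) ^ N → ℝ` is admissible for the condition `C` if, for every
mechanism satisfying `C`, every test function `Ψ` on its codomain and all datasets `X₁, …, X_N`, the
average probability of error of `Ψ` is at least `s (X₁, …, X_N)`. The `N` hypotheses are indexed by
`Fin N`. -/
def IsAdmissible {𝒳 : Type u} {n N : ℕ} (C : MechanismCondition.{u, w} 𝒳 n)
    (s : (Fin N → Fin n → 𝒳) → ℝ) : Prop :=
  ∀ (𝒴 : Type w) [MeasurableSpace 𝒴] (M : Mechanism 𝒳 n 𝒴), C 𝒴 M →
    ∀ Ψ : 𝒴 → Fin N, Measurable Ψ →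
      ∀ X : Fin N → Fin n → 𝒳,
        s X ≤ (1 / (N : ℝ)) * ∑ i : Fin N, (M (X i) : Measure 𝒴).real {y | Ψ y ≠ i}

/-- The Fano matching function for `ρ`-zCDP. -/
noncomputable def fanoMatching {𝒳 : Type u} [DecidableEq 𝒳] {n N : ℕ} (ρ : ℝ)
    (X : Fin N → Fin n → 𝒳) : ℝ :=
  1 - (1 + ρ / (N : ℝ) ^ 2 * ∑ i : Fin N, ∑ j : Fin N, (hammingDist (X i) (X j) : ℝ) ^ 2) /
    Real.log (N : ℝ)

/-- The Le Cam matching function for `ρ`-zCDP, with two hypotheses. -/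
noncomputable def leCamMatching {𝒳 : Type u} [DecidableEq 𝒳] {n : ℕ} (ρ : ℝ)
    (X : Fin 2 → Fin n → 𝒳) : ℝ :=
  1 / 2 * (1 - Real.sqrt (ρ / 2) * (hammingDist (X 0) (X 1) : ℝ))

/-!
# Fano and Le Cam bounds for zero concentrated differential privacy

After composing the mechanism with the test `Ψ`, every dataset `X` carries a distribution `p X` on
the finite set of hypotheses. By Hölder's inequality on each fibre of `Ψ`, the composition does not
increase Rényi divergences (`sum_rpow_mul_rpow_le_of_renyiDiv_le`), so the rest of the argument is
about finite sums.

Group privacy is the bound `D_α(p X ‖ p Y) ≤ ρ k² α` for datasets at Hamming distance `k`. It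
follows by induction on `k` from the weak triangle inequality for Rényi divergences, with Hölder
exponents chosen optimally at each step (`sum_rpow_mul_rpow_le_exp_sq`). Since the Kullback-Leibler
divergence is below every Rényi divergence of level `α > 1`, letting `α` tend to `1` gives
`KL(p X ‖ p Y) ≤ ρ k²`. The Donsker-Varadhan inequality, applied to `l` times the indicator of a
single hypothesis `i`, turns this into
`l * p X i ≤ ρ k² + log (1 + p Y i * (exp l - 1))` for every real `l`
(`ZCDP.mul_measureReal_le`).

Both bounds are instances of this inequality. For Fano, take `l = log N`, bound `log (1 + x)` by
`x`, and average over all pairs `(X i, X j)`; no mixture distribution or mutual information is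
needed. For Le Cam, Hoeffding's lemma bounds the logarithm by `l * p Y i + l² / 8`, and the optimal
`l` gives Pinsker's inequality for the event `Ψ = 0`.
-/

open scoped ENNReal

/-! ### Hölder inequalities for Rényi divergences -/

/-- The contribution of a single event to the data processing inequality: Hölder's inequality for
`P A = ∫ x in A, P.rnDeriv Q x ∂Q` with exponent `α`. -/
lemma measure_rpow_mul_measure_rpow_le {Ω : Type*} [MeasurableSpace Ω] {P Q : Measure Ω}
    [IsFiniteMeasure P] [IsFiniteMeasure Q] (hPQ : P ≪ Q) {α : ℝ} (hα : 1 < α) {A : Set Ω}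
    (hA : MeasurableSet A) :
    P A ^ α * Q A ^ (1 - α) ≤ ∫⁻ x in A, P.rnDeriv Q x ^ (α - 1) ∂P := by
  have hα0 : 0 < α := by linarith
  rcases eq_or_ne (Q A) 0 with h0 | h0
  · simp [hPQ h0, ENNReal.zero_rpow_of_pos hα0]
  have hpq : α.HolderConjugate (Real.conjExponent α) := Real.HolderConjugate.conjExponent hα
  have hL : ∫⁻ x in A, P.rnDeriv Q x ^ (α - 1) ∂P = ∫⁻ x in A, P.rnDeriv Q x ^ α ∂Q := by
    have hm : Measurable fun x => P.rnDeriv Q x ^ (α - 1) :=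
      (Measure.measurable_rnDeriv P Q).pow_const _
    rw [← lintegral_indicator hA, ← lintegral_indicator hA,
      ← lintegral_rnDeriv_mul hPQ (hm.indicator hA).aemeasurable]
    refine lintegral_congr fun x => ?_
    by_cases hx : x ∈ A
    · simp only [Set.indicator_of_mem hx]
      have := ENNReal.rpow_add_of_nonneg (x := P.rnDeriv Q x) 1 (α - 1) (by norm_num)
        (by linarith)
      rw [add_sub_cancel, ENNReal.rpow_one] at this
      exact this.symm
    · simp [Set.indicator_of_notMem hx]
  have hH : P A ≤ (∫⁻ x in A, P.rnDeriv Q x ^ α ∂Q) ^ (1 / α)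
      * Q A ^ (1 / Real.conjExponent α) := by
    have := ENNReal.lintegral_mul_le_Lp_mul_Lq (Q.restrict A) hpq
      (f := P.rnDeriv Q) (g := fun _ => 1) (Measure.measurable_rnDeriv P Q).aemeasurable
      aemeasurable_const
    simpa [Measure.setLIntegral_rnDeriv hPQ] using this
  have hP : P A ^ α ≤ (∫⁻ x in A, P.rnDeriv Q x ^ α ∂Q) * Q A ^ (α - 1) := by
    refine (ENNReal.rpow_le_rpow hH hα0.le).trans_eq ?_
    rw [ENNReal.mul_rpow_of_nonneg _ _ hα0.le, ← ENNReal.rpow_mul, ← ENNReal.rpow_mul,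
      one_div_mul_cancel hα0.ne', ENNReal.rpow_one, Real.conjExponent]
    congr 2
    field_simp
  calc P A ^ α * Q A ^ (1 - α)
      ≤ (∫⁻ x in A, P.rnDeriv Q x ^ α ∂Q) * Q A ^ (α - 1) * Q A ^ (1 - α) := by gcongr
    _ = ∫⁻ x in A, P.rnDeriv Q x ^ (α - 1) ∂P := by
      rw [mul_assoc, ← ENNReal.rpow_add _ _ h0 (measure_ne_top Q A), hL]
      simp

/-- Data processing: coarsening to the fibres of a finite-valued map does not increase the
Rényi divergence. -/
lemma sum_rpow_mul_rpow_le_of_renyiDiv_le {Ω ι : Type*} [MeasurableSpace Ω] [Fintype ι]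
    [MeasurableSpace ι] [MeasurableSingletonClass ι] {P Q : Measure Ω} [IsFiniteMeasure P]
    [IsFiniteMeasure Q] {α c : ℝ} (hα : 1 < α) (h : renyiDiv α P Q ≤ (c : EReal))
    {Ψ : Ω → ι} (hΨ : Measurable Ψ) :
    ∑ i, P.real (Ψ ⁻¹' {i}) ^ α * Q.real (Ψ ⁻¹' {i}) ^ (1 - α) ≤ Real.exp ((α - 1) * c) := by
  have hα' : 0 < α - 1 := by linarith
  by_cases hPQ : P ≪ Q
  swap
  · simp [renyiDiv, hPQ] at h
  rw [renyiDiv, if_pos hPQ, if_neg hα.ne'] at h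
  have hL : ∫⁻ x, P.rnDeriv Q x ^ (α - 1) ∂P ≤ ENNReal.ofReal (Real.exp ((α - 1) * c)) := by
    have h2 := EReal.exp_monotone h
    rw [mul_comm, EReal.exp_mul, ENNReal.exp_log, EReal.exp_coe] at h2
    have h3 := ENNReal.rpow_le_rpow h2 hα'.le
    rw [← ENNReal.rpow_mul, inv_mul_cancel₀ hα'.ne', ENNReal.rpow_one,
      ENNReal.ofReal_rpow_of_nonneg (Real.exp_pos _).le hα'.le, ← Real.exp_mul, mul_comm] at h3
    exact h3
  have hsum : ∑ i, P (Ψ ⁻¹' {i}) ^ α * Q (Ψ ⁻¹' {i}) ^ (1 - α)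
      ≤ ENNReal.ofReal (Real.exp ((α - 1) * c)) := by
    refine le_trans ?_ hL
    calc ∑ i, P (Ψ ⁻¹' {i}) ^ α * Q (Ψ ⁻¹' {i}) ^ (1 - α)
        ≤ ∑ i, ∫⁻ x in Ψ ⁻¹' {i}, P.rnDeriv Q x ^ (α - 1) ∂P :=
          Finset.sum_le_sum fun i _ =>
            measure_rpow_mul_measure_rpow_le hPQ hα (hΨ (measurableSet_singleton i))
      _ = ∫⁻ x in ⋃ i, Ψ ⁻¹' {i}, P.rnDeriv Q x ^ (α - 1) ∂P := by
          rw [lintegral_iUnion (fun i => hΨ (measurableSet_singleton i)), tsum_fintype]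
          intro i j hij
          exact Disjoint.preimage _ (by simpa using hij)
      _ ≤ ∫⁻ x, P.rnDeriv Q x ^ (α - 1) ∂P := setLIntegral_le_lintegral _ _
  have hne : ∑ i, P (Ψ ⁻¹' {i}) ^ α * Q (Ψ ⁻¹' {i}) ^ (1 - α) ≠ ∞ :=
    ne_top_of_le_ne_top ENNReal.ofReal_ne_top hsum
  have := ENNReal.toReal_mono ENNReal.ofReal_ne_top hsum
  rw [ENNReal.toReal_ofReal (Real.exp_pos _).le, ENNReal.toReal_sum
    (fun i hi => ENNReal.sum_ne_top.1 hne i hi)] at this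
  simpa only [ENNReal.toReal_mul, ← ENNReal.toReal_rpow, Measure.real] using this

/-- Weak triangle inequality for Rényi divergences of finite distributions, by Hölder's inequality
after inserting `q i ^ (1 / a - α) * q i ^ (α - 1 / a) = 1` into each summand. -/
lemma sum_rpow_mul_rpow_le_mul {ι : Type*} [Fintype ι] {p q r : ι → ℝ} (hp : ∀ i, 0 ≤ p i)
    (hq : ∀ i, 0 ≤ q i) (hr : ∀ i, 0 ≤ r i) (hpq : ∀ i, q i = 0 → p i = 0) {α a b : ℝ}
    (hα : 1 < α) (hab : a.HolderConjugate b) :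
    ∑ i, p i ^ α * r i ^ (1 - α) ≤
      (∑ i, p i ^ (α * a) * q i ^ (1 - α * a)) ^ (1 / a) *
        (∑ i, q i ^ (1 + (α - 1) * b) * r i ^ (1 - (1 + (α - 1) * b))) ^ (1 / b) := by
  have ha := hab.pos
  have hb := hab.symm.pos
  have hinv : 1 / a + 1 / b = 1 := by simpa using hab.inv_add_inv_eq_one
  have hH := Real.inner_le_Lp_mul_Lq_of_nonneg (s := Finset.univ) hab
    (f := fun i => p i ^ α * q i ^ (1 / a - α)) (g := fun i => q i ^ (α - 1 / a) * r i ^ (1 - α))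
    (fun i _ => mul_nonneg (Real.rpow_nonneg (hp i) _) (Real.rpow_nonneg (hq i) _))
    (fun i _ => mul_nonneg (Real.rpow_nonneg (hq i) _) (Real.rpow_nonneg (hr i) _))
  convert hH using 1
  · refine Finset.sum_congr rfl fun i _ => ?_
    rcases eq_or_ne (q i) 0 with h0 | h0
    · simp [hpq i h0, Real.zero_rpow (by linarith : α ≠ 0)]
    · have h1 : q i ^ (1 / a - α) * q i ^ (α - 1 / a) = 1 := by
        rw [← Real.rpow_add (lt_of_le_of_ne (hq i) h0.symm)]; simp
      linear_combination (-(p i ^ α * r i ^ (1 - α))) * h1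
  · have e1 : (1 / a - α) * a = 1 - α * a := by field_simp
    have e2 : (α - 1 / a) * b = 1 + (α - 1) * b := by
      have : 1 / a = 1 - 1 / b := by linarith
      rw [this]; field_simp; ring
    have e3 : (1 - α) * b = 1 - (1 + (α - 1) * b) := by ring
    congr 2
    · refine Finset.sum_congr rfl fun i _ => ?_
      rw [Real.mul_rpow (Real.rpow_nonneg (hp i) _) (Real.rpow_nonneg (hq i) _),
        ← Real.rpow_mul (hp i), ← Real.rpow_mul (hq i), e1]
    · refine Finset.sum_congr rfl fun i _ => ?_
      rw [Real.mul_rpow (Real.rpow_nonneg (hq i) _) (Real.rpow_nonneg (hr i) _),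
        ← Real.rpow_mul (hq i), ← Real.rpow_mul (hr i), e2, e3]

/-! ### Group privacy -/

lemma exists_hammingDist_le_one_of_le_succ {ι β : Type*} [Fintype ι] [DecidableEq β]
    {X Y : ι → β} {k : ℕ} (h : hammingDist X Y ≤ k + 1) :
    ∃ Z, hammingDist X Z ≤ 1 ∧ hammingDist Z Y ≤ k := by
  classical
  by_cases hk : hammingDist X Y ≤ k
  · exact ⟨X, by simp, hk⟩
  obtain ⟨a, ha⟩ : ∃ a, X a ≠ Y a := by
    by_contra! hXY
    exact hk (by simp [funext hXY])
  refine ⟨Function.update X a (Y a), ?_, ?_⟩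
  · refine (Finset.card_le_card (t := {a}) fun i hi => ?_).trans_eq (Finset.card_singleton a)
    by_contra hia
    simp_all [Function.update_of_ne]
  · refine Nat.lt_succ_iff.1 (lt_of_lt_of_le (Finset.card_lt_card ?_) h)
    refine (Finset.ssubset_iff_of_subset fun i hi => ?_).2 ⟨a, by simpa using ha, by simp⟩
    by_cases hia : i = a
    · subst hia; simp at hi
    · simpa [hia] using hi

/-- Group privacy for finite distributions: the divergence bound grows quadratically with the
Hamming distance. -/
lemma sum_rpow_mul_rpow_le_exp_sq {ι κ β : Type*} [Fintype ι] [Fintype κ] [DecidableEq β]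
    {p : (κ → β) → ι → ℝ} {ρ : ℝ} (hp : ∀ X i, 0 ≤ p X i) (hsum : ∀ X, ∑ i, p X i = 1)
    (hac : ∀ X Y, hammingDist X Y ≤ 1 → ∀ i, p Y i = 0 → p X i = 0)
    (h : ∀ X Y, hammingDist X Y ≤ 1 → ∀ α, 1 < α →
      ∑ i, p X i ^ α * p Y i ^ (1 - α) ≤ Real.exp ((α - 1) * (ρ * α)))
    (k : ℕ) {X Y : κ → β} (hk : hammingDist X Y ≤ k) :
    (∀ i, p Y i = 0 → p X i = 0) ∧ ∀ α, 1 < α →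
      ∑ i, p X i ^ α * p Y i ^ (1 - α) ≤ Real.exp ((α - 1) * (ρ * k ^ 2 * α)) := by
  induction k generalizing X Y with
  | zero =>
    obtain rfl : X = Y := hammingDist_eq_zero.1 (by omega)
    refine ⟨fun _ => id, fun α hα => ?_⟩
    have : ∀ i, p X i ^ α * p X i ^ (1 - α) = p X i := fun i => by
      rw [← Real.rpow_add' (hp X i) (by simp)]
      simp
    simp [this, hsum]
  | succ k ih =>
    obtain ⟨Z, hXZ, hZY⟩ := exists_hammingDist_le_one_of_le_succ hk
    obtain ⟨hacZ, hZ⟩ := ih hZY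
    refine ⟨fun i hi => hac X Z hXZ i (hacZ i hi), fun α hα => ?_⟩
    rcases Nat.eq_zero_or_pos k with rfl | hk0
    · obtain rfl : Z = Y := hammingDist_eq_zero.1 (by omega)
      simpa using h X Z hXZ α hα
    have hkR : (0 : ℝ) < k := by exact_mod_cast hk0
    have hα1 : 0 < α - 1 := by linarith
    have hα0 : 0 < α := by linarith
    -- Among the conjugate exponents `a = 1 + t`, `b = 1 + 1 / t`, the bound is least at
    -- `t = (α - 1) k / α`.
    set a : ℝ := 1 + (α - 1) * k / α with ha_def
    set b : ℝ := 1 + α / ((α - 1) * k) with hb_def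
    have ha : 0 < a := by positivity
    have hb : 0 < b := by positivity
    have ha1 : 1 < a := by
      have : 0 < (α - 1) * k / α := by positivity
      linarith
    have hab : a.HolderConjugate b := by
      rw [Real.holderConjugate_iff]
      refine ⟨ha1, ?_⟩
      rw [ha_def, hb_def]
      field_simp
      ring
    refine (sum_rpow_mul_rpow_le_mul (hp X) (hp Z) (hp Y) (hac X Z hXZ) hα hab).trans ?_
    have h1 := h X Z hXZ (α * a) (by nlinarith)
    have h2 := hZ (1 + (α - 1) * b) (by nlinarith)
    have nn : ∀ (U V : κ → β) (s t : ℝ), 0 ≤ ∑ i, p U i ^ s * p V i ^ t := fun U V s t =>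
      Finset.sum_nonneg fun i _ =>
        mul_nonneg (Real.rpow_nonneg (hp U i) _) (Real.rpow_nonneg (hp V i) _)
    refine (mul_le_mul (Real.rpow_le_rpow (nn _ _ _ _) h1 (by positivity))
      (Real.rpow_le_rpow (nn _ _ _ _) h2 (by positivity)) (Real.rpow_nonneg (nn _ _ _ _) _)
      (Real.rpow_nonneg (Real.exp_pos _).le _)).trans_eq ?_
    rw [← Real.exp_mul, ← Real.exp_mul, ← Real.exp_add]
    congr 1
    have e1 : α * a = α + (α - 1) * k := by rw [ha_def]; field_simp
    have e2 : (α - 1) * b * k = (α - 1) * k + α := by rw [hb_def]; field_simp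
    push_cast
    have e3 : (α * a - 1) * (ρ * (α * a)) * (1 / a) = ρ * α * (α * a - 1) := by field_simp
    have e4 : (1 + (α - 1) * b - 1) * (ρ * k ^ 2 * (1 + (α - 1) * b)) * (1 / b) =
        ρ * (α - 1) * k * (k + (α - 1) * b * k) := by
      rw [show 1 + (α - 1) * b - 1 = (α - 1) * b by ring]
      field_simp
    linear_combination e3 + e4 + ρ * α * e1 + ρ * (α - 1) * k * e2

/-! ### Change of measure -/

/-- A bound `C * α` on all Rényi divergences of level `α > 1` bounds the Kullback-Leibler divergence
by `C`, and the Donsker-Varadhan inequality for `l` times the indicator of `i` then compares the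
two probabilities of `i`. -/
lemma mul_le_add_log_of_sum_rpow_le {ι : Type*} [Fintype ι] {p q : ι → ℝ} {C : ℝ}
    (hp : ∀ i, 0 ≤ p i) (hq : ∀ i, 0 ≤ q i) (hp1 : ∑ i, p i = 1) (hq1 : ∑ i, q i = 1)
    (hpq : ∀ i, q i = 0 → p i = 0)
    (h : ∀ α, 1 < α → ∑ i, p i ^ α * q i ^ (1 - α) ≤ Real.exp ((α - 1) * (C * α)))
    (i : ι) (l : ℝ) :
    l * p i ≤ C + Real.log (1 + q i * (Real.exp l - 1)) := by
  classical
  have hpos : ∀ j, p j ≠ 0 → 0 < p j ∧ 0 < q j := fun j hj =>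
    ⟨lt_of_le_of_ne (hp j) hj.symm, lt_of_le_of_ne (hq j) fun h0 => hj (hpq j h0.symm)⟩
  have hJ : ∀ x : ι → ℝ, Real.exp (∑ j, p j * x j) ≤ ∑ j, p j * Real.exp (x j) := fun x => by
    simpa using convexOn_exp.map_sum_le (t := Finset.univ) (w := p) (p := x)
      (fun j _ => hp j) hp1 (fun _ _ => Set.mem_univ _)
  -- The Kullback-Leibler divergence is at most every Rényi divergence of level `α > 1`.
  have hKL : ∑ j, p j * Real.log (p j / q j) ≤ C := by
    have hα : ∀ α, 1 < α → ∑ j, p j * Real.log (p j / q j) ≤ C * α := fun α hα => by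
      have h1 : Real.exp (∑ j, p j * ((α - 1) * Real.log (p j / q j)))
          ≤ Real.exp ((α - 1) * (C * α)) := by
        refine ((hJ _).trans_eq ?_).trans (h α hα)
        refine Finset.sum_congr rfl fun j _ => ?_
        by_cases hj : p j = 0
        · simp [hj, Real.zero_rpow (by linarith : α ≠ 0)]
        obtain ⟨h0, h0'⟩ := hpos j hj
        rw [mul_comm (α - 1), ← Real.rpow_def_of_pos (div_pos h0 h0'),
          Real.div_rpow h0.le h0'.le, Real.rpow_sub_one hj, show 1 - α = -(α - 1) by ring,
          Real.rpow_neg h0'.le]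
        field_simp
      have h2 := Real.exp_le_exp.1 h1
      have h3 : ∑ j, p j * ((α - 1) * Real.log (p j / q j))
          = (α - 1) * ∑ j, p j * Real.log (p j / q j) := by
        rw [Finset.mul_sum]
        exact Finset.sum_congr rfl fun j _ => by ring
      rw [h3] at h2
      exact le_of_mul_le_mul_left h2 (by linarith)
    have hlim : Filter.Tendsto (fun α : ℝ => C * α) (nhdsWithin 1 (Set.Ioi 1)) (nhds C) := by
      have : Filter.Tendsto (fun α : ℝ => C * α) (nhds 1) (nhds (C * 1)) :=
        (continuous_const.mul continuous_id).tendsto 1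
      rw [mul_one] at this
      exact this.mono_left nhdsWithin_le_nhds
    exact ge_of_tendsto hlim (Filter.eventually_of_mem self_mem_nhdsWithin hα)
  -- Jensen's inequality for `exp`, with the ratio `q j / p j` multiplied by `exp l` at `j = i`.
  have hDV : Real.exp (l * p i - ∑ j, p j * Real.log (p j / q j))
      ≤ 1 + q i * (Real.exp l - 1) := by
    have h1 := hJ fun j => (if j = i then l else 0) - Real.log (p j / q j)
    have h2 : ∑ j, p j * ((if j = i then l else 0) - Real.log (p j / q j))
        = l * p i - ∑ j, p j * Real.log (p j / q j) := by
      simp [mul_sub, Finset.sum_sub_distrib, mul_comm]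
    rw [h2] at h1
    refine h1.trans ?_
    have h3 : ∑ j, q j * (if j = i then Real.exp l else 1) = 1 + q i * (Real.exp l - 1) := by
      have : ∀ j, q j * (if j = i then Real.exp l else 1)
          = q j + if j = i then q j * (Real.exp l - 1) else 0 := fun j => by
        split_ifs <;> ring
      simp [this, Finset.sum_add_distrib, hq1]
    rw [← h3]
    refine Finset.sum_le_sum fun j _ => ?_
    by_cases hj : p j = 0
    · rw [hj, zero_mul]
      exact mul_nonneg (hq j) (by split_ifs <;> positivity)
    obtain ⟨h0, h0'⟩ := hpos j hj
    rw [Real.exp_sub, Real.exp_log (div_pos h0 h0')]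
    refine le_of_eq ?_
    split_ifs
    · field_simp
    · simp only [Real.exp_zero]
      field_simp
  have := Real.log_le_log (Real.exp_pos _) hDV
  rw [Real.log_exp] at this
  linarith

/-- Hoeffding's lemma for a Bernoulli variable. -/
lemma one_add_mul_exp_sub_one_le {q : ℝ} (h0 : 0 ≤ q) (h1 : q ≤ 1) (l : ℝ) :
    1 + q * (Real.exp l - 1) ≤ Real.exp (l * q + l ^ 2 / 8) := by
  set μ : Measure ℝ := ENNReal.ofReal q • Measure.dirac 1 + ENNReal.ofReal (1 - q) • Measure.dirac 0
    with hμ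
  have : IsProbabilityMeasure μ := ⟨by
    simp [hμ, ← ENNReal.ofReal_add h0 (sub_nonneg.2 h1)]⟩
  have hint : ∀ f : ℝ → ℝ, ∫ x, f x ∂μ = q * f 1 + (1 - q) * f 0 := fun f => by
    rw [hμ, integral_add_measure, integral_smul_measure, integral_smul_measure]
    · simp [h0, h1]
    · exact (integrable_dirac (by simp)).smul_measure ENNReal.ofReal_ne_top
    · exact (integrable_dirac (by simp)).smul_measure ENNReal.ofReal_ne_top
  have hb : ∀ᵐ x ∂μ, id x ∈ Set.Icc (0 : ℝ) 1 := by
    rw [hμ, ae_add_measure_iff]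
    constructor <;> refine Measure.ae_smul_measure ?_ _ <;> simp [ae_dirac_eq]
  have hH := (ProbabilityTheory.hasSubgaussianMGF_of_mem_Icc aemeasurable_id hb).mgf_le l
  rw [ProbabilityTheory.mgf, hint, hint] at hH
  simp only [id, mul_one, mul_zero, add_zero, sub_zero, zero_sub, nnnorm_one] at hH
  norm_num at hH
  have e1 : Real.exp (l * (1 - q)) = Real.exp l * Real.exp (-(l * q)) := by
    rw [← Real.exp_add]; ring_nf
  have e2 : Real.exp (l * q + l ^ 2 / 8) = Real.exp (l * q) * Real.exp (1 / 4 * l ^ 2 / 2) := by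
    rw [← Real.exp_add]; ring_nf
  have e3 : Real.exp (l * q) * Real.exp (-(l * q)) = 1 := by rw [← Real.exp_add]; simp
  rw [e2]
  rw [e1] at hH
  have := mul_le_mul_of_nonneg_left hH (Real.exp_pos (l * q)).le
  refine le_trans (le_of_eq ?_) this
  linear_combination (-(q * Real.exp l + (1 - q))) * e3

/-! ### Testing under zero concentrated differential privacy -/

lemma sum_measureReal_preimage_singleton_eq_one {Ω ι : Type*} [MeasurableSpace Ω] [Fintype ι]
    [MeasurableSpace ι] [MeasurableSingletonClass ι] (P : Measure Ω) [IsProbabilityMeasure P]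
    {Ψ : Ω → ι} (hΨ : Measurable Ψ) : ∑ i, P.real (Ψ ⁻¹' {i}) = 1 := by
  rw [← measureReal_biUnion_finset _ fun i _ => hΨ (measurableSet_singleton i)]
  · have : ⋃ b ∈ (Finset.univ : Finset ι), Ψ ⁻¹' {b} = Set.univ := by
      ext; simp
    rw [this, probReal_univ]
  · exact fun i _ j _ hij => Disjoint.preimage _ (by simpa using hij)

/-- The comparison of the probabilities of one test outcome under two datasets from which both the
Fano and the Le Cam bound are derived. -/
lemma ZCDP.mul_measureReal_le {𝒳 : Type u} [DecidableEq 𝒳] {n N : ℕ} {ρ : ℝ} {𝒴 : Type w}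
    [MeasurableSpace 𝒴] {M : Mechanism 𝒳 n 𝒴} (hM : ZCDP ρ 𝒴 M) {Ψ : 𝒴 → Fin N}
    (hΨ : Measurable Ψ) (X Y : Fin n → 𝒳) (i : Fin N) (l : ℝ) :
    l * (M X : Measure 𝒴).real (Ψ ⁻¹' {i}) ≤ ρ * (hammingDist X Y : ℝ) ^ 2 +
      Real.log (1 + (M Y : Measure 𝒴).real (Ψ ⁻¹' {i}) * (Real.exp l - 1)) := by
  have hsum : ∀ X, ∑ i, (M X : Measure 𝒴).real (Ψ ⁻¹' {i}) = 1 := fun X =>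
    sum_measureReal_preimage_singleton_eq_one _ hΨ
  have hac : ∀ X Y, hammingDist X Y ≤ 1 → ∀ i, (M Y : Measure 𝒴).real (Ψ ⁻¹' {i}) = 0 →
      (M X : Measure 𝒴).real (Ψ ⁻¹' {i}) = 0 := fun X Y hXY i hi => by
    have hXY' : (M X : Measure 𝒴) ≪ M Y := by
      by_contra hn
      have := hM X Y hXY 2 one_lt_two
      simp only [renyiDiv, if_neg hn, top_le_iff] at this
      exact EReal.coe_ne_top _ this
    rw [measureReal_eq_zero_iff] at hi ⊢
    exact hXY' hi
  obtain ⟨h1, h2⟩ := sum_rpow_mul_rpow_le_exp_sq (ρ := ρ)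
    (p := fun X i => (M X : Measure 𝒴).real (Ψ ⁻¹' {i})) (fun _ _ => measureReal_nonneg) hsum hac
    (fun X Y hXY α hα => sum_rpow_mul_rpow_le_of_renyiDiv_le hα (hM X Y hXY α hα) hΨ)
    _ (le_refl (hammingDist X Y))
  exact mul_le_add_log_of_sum_rpow_le (fun _ => measureReal_nonneg) (fun _ => measureReal_nonneg)
    (hsum X) (hsum Y) h1 h2 i l

lemma measureReal_ne_eq_one_sub {Ω ι : Type*} [MeasurableSpace Ω] [MeasurableSpace ι]
    [MeasurableSingletonClass ι] (P : Measure Ω) [IsProbabilityMeasure P] {Ψ : Ω → ι}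
    (hΨ : Measurable Ψ) (i : ι) : P.real {y | Ψ y ≠ i} = 1 - P.real (Ψ ⁻¹' {i}) :=
  probReal_compl_eq_one_sub (hΨ (measurableSet_singleton i))

lemma isAdmissible_fanoMatching {𝒳 : Type u} [DecidableEq 𝒳] (n N : ℕ) (ρ : ℝ) (hN : 2 ≤ N) :
    IsAdmissible (N := N) (ZCDP.{u, w} (𝒳 := 𝒳) (n := n) ρ) (fanoMatching ρ) := by
  intro 𝒴 _ M hM Ψ hΨ X
  set P : Fin N → Fin N → ℝ := fun j i => (M (X j) : Measure 𝒴).real (Ψ ⁻¹' {i}) with hP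
  set D : ℝ := ∑ i, ∑ j, (hammingDist (X i) (X j) : ℝ) ^ 2 with hD
  have hN1 : (1 : ℝ) < N := by exact_mod_cast hN
  have hN0 : (0 : ℝ) < N := by linarith
  have hL : 0 < Real.log N := Real.log_pos hN1
  -- The tilting parameter `log N` makes the second term sum to `N * (N - 1)`.
  have hij : ∀ i j, Real.log N * P i i ≤
      ρ * (hammingDist (X i) (X j) : ℝ) ^ 2 + P j i * (N - 1) := fun i j => by
    have h := hM.mul_measureReal_le hΨ (X i) (X j) i (Real.log N)
    rw [Real.exp_log hN0] at h
    have hnn : 0 ≤ P j i * (N - 1) := mul_nonneg measureReal_nonneg (by linarith)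
    have := Real.log_le_sub_one_of_pos (show 0 < 1 + P j i * (N - 1) by linarith)
    simp only [hP] at this ⊢
    linarith
  have hsum : N * (Real.log N * ∑ i, P i i) ≤ ρ * D + N * (N - 1) := by
    have h := Finset.sum_le_sum fun i (_ : i ∈ Finset.univ) =>
      Finset.sum_le_sum fun j (_ : j ∈ Finset.univ) => hij i j
    have h1 : ∑ i, ∑ j, P j i * ((N : ℝ) - 1) = N * (N - 1) := by
      rw [Finset.sum_comm]
      simp_rw [← Finset.sum_mul, hP, sum_measureReal_preimage_singleton_eq_one _ hΨ]
      simp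
    simp only [Finset.sum_add_distrib, h1, ← Finset.mul_sum, Finset.sum_const, Finset.card_univ,
      Fintype.card_fin, nsmul_eq_mul] at h
    linarith
  simp only [fanoMatching, measureReal_ne_eq_one_sub _ hΨ, Finset.sum_sub_distrib,
    Finset.sum_const, Finset.card_univ, Fintype.card_fin, nsmul_eq_mul, mul_one]
  rw [← hD, mul_sub, one_div_mul_cancel hN0.ne']
  refine sub_le_sub_left ?_ 1
  rw [le_div_iff₀ hL]
  change 1 / (N : ℝ) * (∑ i, P i i) * Real.log N ≤ _
  have e1 : 1 / (N : ℝ) * (∑ i, P i i) * Real.log N =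
      N * (Real.log N * ∑ i, P i i) / N ^ 2 := by field_simp
  have e2 : 1 + ρ / (N : ℝ) ^ 2 * D = (ρ * D + N * N) / N ^ 2 := by field_simp; ring
  rw [e1, e2]
  gcongr
  linarith

lemma isAdmissible_leCamMatching {𝒳 : Type u} [DecidableEq 𝒳] (n : ℕ) (ρ : ℝ) (hρ : 0 < ρ) :
    IsAdmissible (N := 2) (ZCDP.{u, w} (𝒳 := 𝒳) (n := n) ρ) (leCamMatching ρ) := by
  intro 𝒴 _ M hM Ψ hΨ X
  set p := (M (X 0) : Measure 𝒴).real (Ψ ⁻¹' {0}) with hp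
  set q := (M (X 1) : Measure 𝒴).real (Ψ ⁻¹' {0}) with hq
  have hq0 : 0 ≤ q := measureReal_nonneg
  have hq1 : q ≤ 1 := measureReal_le_one
  -- Pinsker's inequality for the event `Ψ = 0`: `l * (p - q) - l ^ 2 / 8` is largest at
  -- `l = 4 * (p - q)`.
  have hpin : 2 * (p - q) ^ 2 ≤ ρ * (hammingDist (X 0) (X 1) : ℝ) ^ 2 := by
    have h := hM.mul_measureReal_le hΨ (X 0) (X 1) 0 (4 * (p - q))
    rw [← hp, ← hq] at h
    have hpos : 0 < 1 + q * (Real.exp (4 * (p - q)) - 1) := by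
      rcases hq0.eq_or_lt with h0 | h0
      · simp [← h0]
      · have := mul_pos h0 (Real.exp_pos (4 * (p - q)))
        linarith
    have := Real.log_le_log hpos (one_add_mul_exp_sub_one_le hq0 hq1 (4 * (p - q)))
    rw [Real.log_exp] at this
    nlinarith
  have hpq : p - q ≤ Real.sqrt (ρ / 2) * (hammingDist (X 0) (X 1) : ℝ) := by
    refine le_of_abs_le (abs_le_of_sq_le_sq ?_ (by positivity))
    rw [mul_pow, Real.sq_sqrt (by positivity)]
    linarith
  have h1 : (M (X 1) : Measure 𝒴).real (Ψ ⁻¹' {1}) = 1 - q := by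
    have := sum_measureReal_preimage_singleton_eq_one (M (X 1) : Measure 𝒴) hΨ
    rw [Fin.sum_univ_two] at this
    linarith
  simp only [leCamMatching, measureReal_ne_eq_one_sub _ hΨ, Fin.sum_univ_two, h1, ← hp]
  push_cast
  linarith

theorem mainTheorem7 {𝒳 : Type u} [DecidableEq 𝒳] (n : ℕ) (ρ : ℝ) (hρ : 0 < ρ) :
    (∀ N : ℕ, 2 ≤ N →
      IsAdmissible (N := N) (ZCDP.{u, w} (𝒳 := 𝒳) (n := n) ρ) (fanoMatching ρ)) ∧
    IsAdmissible (N := 2) (ZCDP.{u, w} (𝒳 := 𝒳) (n := n) ρ) (leCamMatching ρ) := by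
  exact ⟨fun N hN => isAdmissible_fanoMatching n N ρ hN, isAdmissible_leCamMatching n ρ hρ⟩
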